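/- Let $G$ be a connected simple graph on a finite set of $n>2$ vertices. For a vertex $i$ with neighbourhood $\mathcal N(i)$ let $g_i=X^{(i)}\bigotimes_{j\in\mathcal N(i)}Z^{(j)}$, where $X,Y,Z$ are the Pauli matrices, acting on $n$ qubits indexed by the vertices of $G$; let $|G\rangle$ be the graph state of $G$, i.e. the unit vector (unique up to a phase) with $g_i|G\rangle=|G\rangle$ for every $i$, and let $S$ be the set of all products of the generators $g_i$ other than the identity. Every $s\in S$ has the form $\pm\bigotimes_k O^{(k)}$ with $O^{(k)}\in\{I,X,Y,Z\}$. An *event* of $s$ assigns an outcome $\pm1$ to each qubit $k$ with $O^{(k)}\neq I$ (the outcome of measuring $O^{(k)}$; nothing is measured at the other qubits), such that the product of these outcomes is the sign of $s$; there are $2^{w-1}$ such events if $s$ has $w$ factors $O^{(k)}\ne I$. Two events are *exclusive* if there is a qubit at which both make the same measurement but with different outcomes. Let $H=H(G)$ be the graph whose vertices are the events of all $s\in S$ and whose edges are the pairs of exclusive events. Let $\alpha(H)$ be the independence number of $H$. Let $$\vartheta(H)=\max\sum_{u\in V(H)}|\langle\psi|v_u\rangle|^2,$$ the maximum being over all $k$,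 all unit vectors $\psi\in\mathbb C^k$ and all orthogonal representations of $H$ in $\mathbb C^k$, i.e. families $(v_u)_{u\in V(H)}$ of unit vectors of $\mathbb C^k$ with $v_u\perp v_w$ whenever $u,w$ are adjacent. Let $$\alpha^*(H)=\max\sum_{u\in V(H)}w_u,$$ the maximum being over all weights $0\le w_u\le1$ with $\sum_{u\in C}w_u\le1$ for every clique $C$ of $H$. Then both maxima are attained, and $$\alpha(H)<\vartheta(H)=\alpha^*(H)=2^n-1 .$$ The same holds for the graph whose vertices are only those outcomes of the measurements of the factors $O^{(k)}\neq I$ of some $s\in S$ that occur with non-zero probability in the state $|G\rangle$, with exclusive outcomes adjacent. -/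

import Mathlib

namespace EventExclusivity

/-! ### Graph parameters -/

section GraphParameters

variable {W : Type*} [Fintype W]

/-- A (normalised, complex) orthogonal representation of a graph: vertices are mapped to unit
vectors of `ℂ^k`, adjacent vertices to orthogonal vectors. -/
def IsOrthogonalRepresentation (H : SimpleGraph W) {k : ℕ}
    (v : W → EuclideanSpace ℂ (Fin k)) : Prop :=
  (∀ u, ‖v u‖ = 1) ∧ ∀ u w, H.Adj u w → inner ℂ (v u) (v w) = 0

/-- The values `∑ i, |⟨ψ|v_i⟩|²`, over all dimensions `k`, all orthogonal representations `v` in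
`ℂ^k` and all unit vectors `ψ` of `ℂ^k`. -/
def lovaszValues (H : SimpleGraph W) : Set ℝ :=
  {r | ∃ (k : ℕ) (v : W → EuclideanSpace ℂ (Fin k)) (ψ : EuclideanSpace ℂ (Fin k)),
    IsOrthogonalRepresentation H v ∧ ‖ψ‖ = 1 ∧ r = ∑ u, ‖(inner ℂ ψ (v u) : ℂ)‖ ^ 2}

/-- The Lovász number `ϑ(H)`. -/
noncomputable def lovaszNumber (H : SimpleGraph W) : ℝ := sSup (lovaszValues H)

/-- Feasible weights of the fractional packing program: weights in `[0, 1]` whose sum over each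
clique is at most `1`. -/
def IsFractionalPacking (H : SimpleGraph W) (w : W → ℝ) : Prop :=
  (∀ u, 0 ≤ w u ∧ w u ≤ 1) ∧ ∀ C : Finset W, H.IsClique (C : Set W) → ∑ u ∈ C, w u ≤ 1

/-- The total weights of the feasible solutions of the fractional packing program. -/
def fractionalPackingValues (H : SimpleGraph W) : Set ℝ :=
  {r | ∃ w : W → ℝ, IsFractionalPacking H w ∧ r = ∑ u, w u}

/-- The fractional packing number `α*(H)`. -/
noncomputable def fractionalPackingNumber (H : SimpleGraph W) : ℝ :=
  sSup (fractionalPackingValues H)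

end GraphParameters

/-! ### Graph states and their stabilizers -/

/-- The three non-trivial single-qubit Pauli measurements. -/
inductive Axis where
  | X
  | Y
  | Z

/-- The Pauli matrices. -/
noncomputable def Axis.matrix : Axis → Matrix (Fin 2) (Fin 2) ℂ
  | .X => !![0, 1; 1, 0]
  | .Y => !![0, -Complex.I; Complex.I, 0]
  | .Z => !![1, 0; 0, -1]

instance : Finite Axis :=
  Finite.of_injective (fun a : Axis => match a with | .X => (0 : Fin 3) | .Y => 1 | .Z => 2)
    (by intro a b h; cases a <;> cases b <;> simp_all)

section GraphState

variable {V : Type*} [Fintype V] [DecidableEq V]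

/-- The operator `⨂_k A_k` on the qubits indexed by `V`, in the computational basis, whose
elements are the bit strings `V → Fin 2`. -/
def tensorOp (A : V → Matrix (Fin 2) (Fin 2) ℂ) : Matrix (V → Fin 2) (V → Fin 2) ℂ :=
  Matrix.of fun x y => ∏ k, A k (x k) (y k)

open Classical in
/-- The generator `g_i`: `X` on qubit `i`, `Z` on the neighbours of `i`, identity elsewhere. -/
noncomputable def generator (G : SimpleGraph V) (i : V) : Matrix (V → Fin 2) (V → Fin 2) ℂ :=
  tensorOp fun k => if k = i then Axis.X.matrix else if G.Adj i k then Axis.Z.matrix else 1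

/-- The stabilizing operators: all products of generators, with the identity removed. -/
def stabilizers (G : SimpleGraph V) : Set (Matrix (V → Fin 2) (V → Fin 2) ℂ) :=
  {s | s ∈ Submonoid.closure (Set.range (generator G)) ∧ s ≠ 1}

/-- `ψ` is the graph state `|G⟩` (which is unique up to a phase): a unit vector that is fixed by
every generator. -/
def IsGraphState (G : SimpleGraph V) (ψ : (V → Fin 2) → ℂ) : Prop :=
  star ψ ⬝ᵥ ψ = 1 ∧ ∀ i, (generator G i).mulVec ψ = ψ

/-! ### Events and the event-exclusivity graph -/

/-- At every qubit, either no measurement is made (`none`, written `I`), or one of `X`, `Y`, `Z` is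
measured and an outcome `1` or `-1` is obtained (the letters `x, x̲, y, y̲, z, z̲`). -/
abbrev OutcomeString (V : Type*) := V → Option (Axis × ℤˣ)

/-- The tensor product of the measured Pauli matrices, with the identity where nothing is
measured. -/
noncomputable def measuredOp (e : OutcomeString V) : Matrix (V → Fin 2) (V → Fin 2) ℂ :=
  tensorOp fun k => match e k with
    | none => 1
    | some (a, _) => a.matrix

/-- The projector on the joint outcome `e`: at a measured qubit, `(1 ± σ) / 2` is the projector on
the eigenspace of the Pauli matrix `σ` with eigenvalue `±1`. -/
noncomputable def outcomeProjector (e : OutcomeString V) : Matrix (V → Fin 2) (V → Fin 2) ℂ :=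
  tensorOp fun k => match e k with
    | none => 1
    | some (a, ε) => (1 / 2 : ℂ) • (1 + ((ε : ℤ) : ℂ) • a.matrix)

/-- The probability `⟨ψ|P_e|ψ⟩` of the joint outcome `e` in the state `ψ`. -/
noncomputable def outcomeProbability (ψ : (V → Fin 2) → ℂ) (e : OutcomeString V) : ℂ :=
  star ψ ⬝ᵥ (outcomeProjector e).mulVec ψ

/-- The product of all the outcomes in `e`. -/
def outcomeSign (e : OutcomeString V) : ℤˣ :=
  ∏ k, match e k with
    | none => 1
    | some (_, ε) => ε

/-- The events of the stabilizing operators: `e` is an event of `s = ± ⨂_k O_k` if `e` consists of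
outcomes of the single-qubit measurements `O_k` whose product is the sign of `s`, i.e. outcomes for
which the value of `s` is `1`. An operator of weight `w` has `2 ^ (w - 1)` events. -/
def stabilizerEvents (G : SimpleGraph V) : Set (OutcomeString V) :=
  {e | ∃ s ∈ stabilizers G, s = ((outcomeSign e : ℤ) : ℂ) • measuredOp e}

/-- The joint outcomes that occur with non-zero probability when the tensor factors of some
stabilizing operator (which carries a sign `ε`) are measured on the graph state. -/
def occurringEvents (G : SimpleGraph V) : Set (OutcomeString V) :=
  {e | (∃ s ∈ stabilizers G, ∃ ε : ℤˣ, s = ((ε : ℤ) : ℂ) • measuredOp e) ∧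
    ∃ ψ, IsGraphState G ψ ∧ outcomeProbability ψ e ≠ 0}

/-- Two outcome strings are exclusive if, at some qubit, the same measurement gives different
outcomes. -/
def Exclusive (e f : OutcomeString V) : Prop :=
  ∃ (k : V) (a : Axis) (ε δ : ℤˣ), e k = some (a, ε) ∧ f k = some (a, δ) ∧ ε ≠ δ

/-- The exclusivity graph of a set of events: adjacent vertices are exclusive events. -/
def exclusivityGraph (E : Set (OutcomeString V)) : SimpleGraph E where
  Adj e f := Exclusive e.1 f.1
  symm := by
    constructor
    rintro e f ⟨k, a, ε, δ, he, hf, h⟩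
    exact ⟨k, a, δ, ε, hf, he, h.symm⟩
  loopless := by
    constructor
    rintro e ⟨k, a, ε, δ, he, hf, h⟩
    rw [he] at hf
    simp_all

noncomputable instance (E : Set (OutcomeString V)) : Fintype E := Fintype.ofFinite _

end GraphState

end EventExclusivity

/-! Up to a phase, a product of generators is the Pauli string `stabilizerString G T` of a vector
`T` over `ZMod 2`. Distinct `T` give distinct strings, so there are `2 ^ n - 1` stabilizing
operators, one for each `T ≠ 0`.

Upper bound: distinct events of one operator share all measurements and differ in some outcome, so
they form a clique. These cliques cover `H`, whence `α* ≤ 2 ^ n - 1`; Bessel's inequality gives `ϑ ≤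
α*`. Lower bound: exclusive events have orthogonal projectors, so the normalised vectors `P_e ψ`,
with `ψ` the graph state, represent `H` orthogonally. Their overlaps with `ψ` are the outcome
probabilities, which sum to `1` for each operator.

Strictness: an independent set of size `2 ^ n - 1` would contain one event of each operator, with
outcomes consistent at every qubit. Around a vertex with two neighbours, four operators then
multiply to `-1` once their factors are paired off qubit by qubit. But `-1` is not a product of
generators, since all of these fix `ψ` (`false_of_compatible_events`, `exists_exclusive_events`). -/

namespace EventExclusivity

set_option linter.unusedSectionVars false

/-! ### Comparison of the two graph parameters -/

section GraphParameters

variable {W : Type*} [Fintype W] {H : SimpleGraph W}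

/-- By the Bessel inequality, the overlaps of an orthogonal representation are a fractional
packing. -/
theorem lovaszValues_subset_fractionalPackingValues :
    lovaszValues H ⊆ fractionalPackingValues H := by
  rintro r ⟨k, v, ψ, ⟨hv, ho⟩, hψ, rfl⟩
  have bessel : ∀ C : Finset W, H.IsClique (C : Set W) →
      ∑ u ∈ C, ‖(inner ℂ ψ (v u) : ℂ)‖ ^ 2 ≤ 1 := by
    intro C hC
    have h : Orthonormal ℂ (fun u : C => v u) :=
      ⟨fun u => hv u, fun a b hab => ho _ _ (hC a.2 b.2 fun h => hab (Subtype.ext h))⟩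
    have h1 := h.sum_inner_products_le ψ (s := Finset.univ)
    rw [hψ, one_pow] at h1
    refine le_trans (le_of_eq ?_) h1
    rw [← Finset.sum_coe_sort C]
    exact Finset.sum_congr rfl fun u _ => by rw [norm_inner_symm]
  refine ⟨fun u => ‖(inner ℂ ψ (v u) : ℂ)‖ ^ 2, ⟨fun u => ⟨by positivity, ?_⟩, bessel⟩, rfl⟩
  -- A single vertex is a clique, so the bound `1` on each weight is an instance of the clique
  -- bound.
  simpa using bessel {u} (by simp)

/-- The index set of the coordinates of an orthogonal representation is immaterial. -/
theorem mem_lovaszValues {ι : Type*} [Fintype ι] (v : W → EuclideanSpace ℂ ι)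
    (ψ : EuclideanSpace ℂ ι) (hv : ∀ u, ‖v u‖ = 1)
    (ho : ∀ u w, H.Adj u w → inner ℂ (v u) (v w) = 0) (hψ : ‖ψ‖ = 1) :
    ∑ u, ‖(inner ℂ ψ (v u) : ℂ)‖ ^ 2 ∈ lovaszValues H := by
  let L := LinearIsometryEquiv.piLpCongrLeft 2 ℂ ℂ (Fintype.equivFin ι)
  refine ⟨Fintype.card ι, fun u => L (v u), L ψ, ⟨fun u => ?_, fun u w h => ?_⟩, ?_, ?_⟩
  · exact (L.norm_map _).trans (hv u)
  · exact (L.inner_map_map _ _).trans (ho u w h)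
  · exact (L.norm_map _).trans hψ
  · exact Finset.sum_congr rfl fun u _ => by
      rw [show (inner ℂ (L ψ) (L (v u)) : ℂ) = inner ℂ ψ (v u) from L.inner_map_map _ _]

/-- If the vertices are covered by `N` cliques, then the fractional packing number is at most
`N`. -/
theorem sum_le_card_of_clique_cover {κ : Type*} [DecidableEq κ] {w : W → ℝ}
    (hw : IsFractionalPacking H w) (f : W → κ) (S : Finset κ) (hf : ∀ u, f u ∈ S)
    (hH : ∀ u v, u ≠ v → f u = f v → H.Adj u v) : ∑ u, w u ≤ S.card := by
  rw [← Finset.sum_fiberwise_of_maps_to (s := Finset.univ) (t := S) (g := f) fun u _ => hf u]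
  refine (Finset.sum_le_card_nsmul S _ 1 fun j _ => hw.2 _ ?_).trans (by simp)
  intro u hu v hv huv
  simp only [Finset.coe_filter, Finset.mem_univ, true_and, Set.mem_ofPred_eq] at hu hv
  exact hH u v huv (hu.trans hv.symm)

end GraphParameters

/-! ### Tensor products of operators -/

section TensorProducts

variable {V : Type*} [Fintype V] [DecidableEq V]

theorem tensorOp_mul (A B : V → Matrix (Fin 2) (Fin 2) ℂ) :
    tensorOp A * tensorOp B = tensorOp fun k => A k * B k := by
  ext x y
  simp only [tensorOp, Matrix.mul_apply, Matrix.of_apply, Finset.prod_univ_sum,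
    Fintype.piFinset_univ, Finset.prod_mul_distrib]

theorem tensorOp_one : tensorOp (fun _ : V => (1 : Matrix (Fin 2) (Fin 2) ℂ)) = 1 := by
  ext x y
  simp only [tensorOp, Matrix.of_apply, Matrix.one_apply]
  by_cases h : x = y
  · simp [h]
  · rw [if_neg h]
    obtain ⟨k, hk⟩ := Function.ne_iff.mp h
    exact Finset.prod_eq_zero (Finset.mem_univ k) (if_neg hk)

theorem trace_tensorOp (A : V → Matrix (Fin 2) (Fin 2) ℂ) :
    (tensorOp A).trace = ∏ k, (A k).trace := by
  simp only [tensorOp, Matrix.trace, Matrix.diag, Matrix.of_apply, Finset.prod_univ_sum,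
    Fintype.piFinset_univ]

theorem tensorOp_smul (c : V → ℂ) (A : V → Matrix (Fin 2) (Fin 2) ℂ) :
    tensorOp (fun k => c k • A k) = (∏ k, c k) • tensorOp A := by
  ext x y
  simp [tensorOp, Finset.prod_mul_distrib]

theorem tensorOp_conjTranspose (A : V → Matrix (Fin 2) (Fin 2) ℂ) :
    (tensorOp A).conjTranspose = tensorOp fun k => (A k).conjTranspose := by
  ext x y
  simp [tensorOp, Matrix.conjTranspose_apply]

theorem tensorOp_eq_zero {A : V → Matrix (Fin 2) (Fin 2) ℂ} {k : V} (h : A k = 0) :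
    tensorOp A = 0 := by
  ext x y
  exact Finset.prod_eq_zero (Finset.mem_univ k) (by rw [h]; rfl)

theorem sum_tensorOp {κ : Type*} (t : V → Finset κ) (F : κ → Matrix (Fin 2) (Fin 2) ℂ) :
    ∑ e ∈ Fintype.piFinset t, tensorOp (fun k => F (e k)) =
      tensorOp fun k => ∑ o ∈ t k, F o := by
  ext x y
  simp only [tensorOp, Matrix.sum_apply, Matrix.of_apply, Finset.prod_univ_sum]

/-! ### Pauli strings -/

/-- The identity or a Pauli matrix. -/
noncomputable def pauliMatrix : Option Axis → Matrix (Fin 2) (Fin 2) ℂ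
  | none => 1
  | some a => a.matrix

/-- The Pauli matrix that is `X ^ a * Z ^ b` up to a phase. -/
def pauliAxis (a b : ZMod 2) : Option Axis :=
  if a = 0 then if b = 0 then none else some .Z else if b = 0 then some .X else some .Y

theorem pauliAxis_injective {a b a' b' : ZMod 2} (h : pauliAxis a b = pauliAxis a' b') :
    a = a' ∧ b = b' := by
  have h01 : (1 : ZMod 2) ≠ 0 := by decide
  have key : ∀ a : ZMod 2, a = 0 ∨ a = 1 := by decide
  rcases key a with rfl | rfl <;> rcases key b with rfl | rfl <;>
    rcases key a' with rfl | rfl <;> rcases key b' with rfl | rfl <;>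
    simp_all [pauliAxis]

theorem axis_matrix_mul_self (a : Axis) : a.matrix * a.matrix = 1 := by
  cases a <;> ext i j <;> fin_cases i <;> fin_cases j <;>
    simp [Axis.matrix, Matrix.mul_apply, Fin.sum_univ_two]

theorem pauliMatrix_mul_self (a : Option Axis) : pauliMatrix a * pauliMatrix a = 1 := by
  cases a with
  | none => simp [pauliMatrix]
  | some a => exact axis_matrix_mul_self a

theorem axis_matrix_conjTranspose (a : Axis) : a.matrix.conjTranspose = a.matrix := by
  cases a <;> ext i j <;> fin_cases i <;> fin_cases j <;>
    simp [Axis.matrix, Matrix.conjTranspose_apply]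

theorem trace_axis_matrix (a : Axis) : a.matrix.trace = 0 := by
  cases a <;> simp [Axis.matrix, Matrix.trace, Fin.sum_univ_two]

theorem axis_matrix_anticomm {a b : Axis} (h : a ≠ b) :
    a.matrix * b.matrix = -(b.matrix * a.matrix) := by
  cases a <;> cases b <;> first
    | exact absurd rfl h
    | (ext i j; fin_cases i <;> fin_cases j <;>
        simp [Axis.matrix, Matrix.mul_apply, Fin.sum_univ_two])

/-- Distinct non-identity Pauli matrices anticommute, so cyclicity of the trace makes the trace of
their product its own negative. -/
theorem trace_pauliMatrix_mul {a b : Option Axis}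
    (h : (pauliMatrix a * pauliMatrix b).trace ≠ 0) : a = b := by
  by_contra hab
  apply h
  rcases a with _ | a <;> rcases b with _ | b
  · exact absurd rfl hab
  · simp [pauliMatrix, trace_axis_matrix]
  · simp [pauliMatrix, trace_axis_matrix]
  · have h1 := congrArg Matrix.trace (axis_matrix_anticomm fun h => hab (congrArg some h))
    rw [Matrix.trace_neg, Matrix.trace_mul_comm b.matrix] at h1
    exact self_eq_neg.mp h1

/-- Up to phase the Pauli matrices form the group `(ZMod 2)²`. The phase need not be tracked:
membership in the stabilizer group later forces it to be a sign. -/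
theorem pauliMatrix_mul (a b a' b' : ZMod 2) :
    ∃ c : ℂ, pauliMatrix (pauliAxis a b) * pauliMatrix (pauliAxis a' b') =
      c • pauliMatrix (pauliAxis (a + a') (b + b')) := by
  have h2 : (1 : ZMod 2) + 1 = 0 := by decide
  have h01 : (1 : ZMod 2) ≠ 0 := by decide
  have key : ∀ a : ZMod 2, a = 0 ∨ a = 1 := by decide
  have hXZ : Axis.X.matrix * Axis.Z.matrix = (-Complex.I) • Axis.Y.matrix := by
    ext i j; fin_cases i <;> fin_cases j <;>
      simp [Axis.matrix, Matrix.mul_apply, Fin.sum_univ_two]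
  have hXY : Axis.X.matrix * Axis.Y.matrix = Complex.I • Axis.Z.matrix := by
    ext i j; fin_cases i <;> fin_cases j <;>
      simp [Axis.matrix, Matrix.mul_apply, Fin.sum_univ_two]
  have hYZ : Axis.Y.matrix * Axis.Z.matrix = Complex.I • Axis.X.matrix := by
    ext i j; fin_cases i <;> fin_cases j <;>
      simp [Axis.matrix, Matrix.mul_apply, Fin.sum_univ_two]
  have hZX : Axis.Z.matrix * Axis.X.matrix = Complex.I • Axis.Y.matrix := by
    rw [axis_matrix_anticomm (by simp), hXZ, neg_smul, neg_neg]
  have hYX : Axis.Y.matrix * Axis.X.matrix = (-Complex.I) • Axis.Z.matrix := by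
    rw [axis_matrix_anticomm (by simp), hXY, neg_smul]
  have hZY : Axis.Z.matrix * Axis.Y.matrix = (-Complex.I) • Axis.X.matrix := by
    rw [axis_matrix_anticomm (by simp), hYZ, neg_smul]
  rcases key a with rfl | rfl <;> rcases key b with rfl | rfl <;>
    rcases key a' with rfl | rfl <;> rcases key b' with rfl | rfl <;>
    simp only [pauliAxis, h2, h01, add_zero, zero_add, if_true, if_false, pauliMatrix, one_mul,
      mul_one, axis_matrix_mul_self, hXZ, hXY, hYZ, hZX, hYX, hZY] <;>
    first
    | exact ⟨1, (one_smul _ _).symm⟩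
    | exact ⟨_, rfl⟩

/-- Proportional Pauli strings are equal. -/
theorem eq_of_tensorOp_pauliMatrix_eq_smul {a b : V → Option Axis} {c : ℂ}
    (h : tensorOp (fun k => pauliMatrix (a k)) = c • tensorOp fun k => pauliMatrix (b k)) :
    a = b := by
  -- Multiplying by the string of `a` and taking traces leaves `2 ^ n` on the left, while the right
  -- side vanishes if the strings differ at any qubit.
  have h2 := congrArg (fun M => ((tensorOp fun k => pauliMatrix (a k)) * M).trace) h
  simp only [Matrix.mul_smul, tensorOp_mul, pauliMatrix_mul_self,
    Matrix.trace_smul, trace_tensorOp, smul_eq_mul] at h2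
  funext k
  refine trace_pauliMatrix_mul fun h0 => ?_
  have h3 : ∏ k, (pauliMatrix (a k) * pauliMatrix (b k)).trace = 0 :=
    Finset.prod_eq_zero (Finset.mem_univ k) h0
  rw [h3, mul_zero] at h2
  simp [Matrix.trace_one] at h2

/-! ### The stabilizer group -/

variable (G : SimpleGraph V)

open Classical in
/-- The number of neighbours of `k` in the set with indicator function `T`, modulo `2`. -/
noncomputable def nbrParity (T : V → ZMod 2) (k : V) : ZMod 2 :=
  ∑ j, if G.Adj k j then T j else 0

/-- The Pauli string of the product of the generators in the set with indicator function `T`. -/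
noncomputable def stabilizerAxes (T : V → ZMod 2) (k : V) : Option Axis :=
  pauliAxis (T k) (nbrParity G T k)

theorem nbrParity_add (T U : V → ZMod 2) (k : V) :
    nbrParity G (T + U) k = nbrParity G T k + nbrParity G U k := by
  classical
  simp only [nbrParity, ← Finset.sum_add_distrib]
  exact Finset.sum_congr rfl fun j _ => by split_ifs <;> simp

open Classical in
theorem nbrParity_single (i k : V) :
    nbrParity G (Pi.single i 1) k = if G.Adj k i then 1 else 0 := by
  unfold nbrParity
  rw [Finset.sum_eq_single i]
  · simp
  · intro j _ hj
    simp [hj]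
  · simp

theorem stabilizerAxes_injective : Function.Injective (stabilizerAxes G) := fun T U h => by
  funext k
  exact (pauliAxis_injective (congrFun h k)).1

/-- The Pauli string of a product of generators, as an operator. -/
noncomputable def stabilizerString (T : V → ZMod 2) : Matrix (V → Fin 2) (V → Fin 2) ℂ :=
  tensorOp fun k => pauliMatrix (stabilizerAxes G T k)

theorem stabilizerString_zero : stabilizerString G 0 = 1 := by
  simp [stabilizerString, stabilizerAxes, nbrParity, pauliAxis, pauliMatrix, tensorOp_one]

theorem stabilizerString_mul_self (T : V → ZMod 2) :
    stabilizerString G T * stabilizerString G T = 1 := by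
  simp [stabilizerString, tensorOp_mul, pauliMatrix_mul_self, tensorOp_one]

theorem stabilizerString_mul (T U : V → ZMod 2) :
    ∃ c : ℂ, stabilizerString G T * stabilizerString G U = c • stabilizerString G (T + U) := by
  choose c hc using fun k =>
    pauliMatrix_mul (T k) (nbrParity G T k) (U k) (nbrParity G U k)
  refine ⟨∏ k, c k, ?_⟩
  simp only [stabilizerString, stabilizerAxes, tensorOp_mul, hc, tensorOp_smul, Pi.add_apply,
    nbrParity_add]

theorem generator_eq_stabilizerString (i : V) :
    generator G i = stabilizerString G (Pi.single i 1) := by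
  classical
  unfold generator stabilizerString stabilizerAxes
  congr 1
  funext k
  rw [nbrParity_single]
  by_cases h : k = i
  · subst h
    simp [pauliAxis, pauliMatrix]
  · by_cases h1 : G.Adj i k
    · simp [h, h1, h1.symm, pauliAxis, pauliMatrix]
    · have h2 : ¬ G.Adj k i := fun h => h1 h.symm
      simp [h, h1, h2, pauliAxis, pauliMatrix]

theorem exists_eq_smul_stabilizerString {s : Matrix (V → Fin 2) (V → Fin 2) ℂ}
    (hs : s ∈ Submonoid.closure (Set.range (generator G))) :
    ∃ (T : V → ZMod 2) (c : ℂ), s = c • stabilizerString G T := by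
  induction hs using Submonoid.closure_induction with
  | mem s hs =>
    obtain ⟨i, rfl⟩ := hs
    exact ⟨_, 1, by rw [one_smul, generator_eq_stabilizerString]⟩
  | one => exact ⟨0, 1, by rw [one_smul, stabilizerString_zero]⟩
  | mul s t _ _ hs ht =>
    obtain ⟨T, c, rfl⟩ := hs
    obtain ⟨U, d, rfl⟩ := ht
    obtain ⟨b, hb⟩ := stabilizerString_mul G T U
    exact ⟨T + U, c * d * b, by
      rw [Matrix.smul_mul, Matrix.mul_smul, hb, smul_smul, smul_smul]⟩

theorem exists_mem_closure_eq_smul_stabilizerString (T : V → ZMod 2) :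
    ∃ s ∈ Submonoid.closure (Set.range (generator G)),
      ∃ c : ℂ, s = c • stabilizerString G T := by
  have key : ∀ A : Finset V, ∃ s ∈ Submonoid.closure (Set.range (generator G)),
      ∃ c : ℂ, s = c • stabilizerString G (∑ i ∈ A, Pi.single i (T i)) := by
    intro A
    induction A using Finset.induction_on with
    | empty => exact ⟨1, one_mem _, 1, by simp [stabilizerString_zero]⟩
    | insert i A hi ih =>
      obtain ⟨s, hs, c, rfl⟩ := ih
      rw [Finset.sum_insert hi]
      have h01 : ∀ a : ZMod 2, a = 0 ∨ a = 1 := by decide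
      rcases h01 (T i) with h | h
      · exact ⟨_, hs, c, by rw [h, Pi.single_zero, zero_add]⟩
      · obtain ⟨b, hb⟩ := stabilizerString_mul G (Pi.single i 1) (∑ i ∈ A, Pi.single i (T i))
        refine ⟨_, mul_mem (Submonoid.subset_closure ⟨i, rfl⟩) hs, c * b, ?_⟩
        rw [generator_eq_stabilizerString, Matrix.mul_smul, hb, smul_smul, h]
  simpa only [Finset.univ_sum_single] using key Finset.univ

/-! ### Existence of the graph state -/

theorem generator_mul_self (i : V) : generator G i * generator G i = 1 := by
  rw [generator_eq_stabilizerString, stabilizerString_mul_self]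

/-- For adjacent `i` and `j` the factors anticommute at exactly the two qubits `i` and `j`, and the
two signs cancel; `c` records these signs. -/
theorem generator_commute (i j : V) :
    generator G i * generator G j = generator G j * generator G i := by
  classical
  rcases eq_or_ne i j with rfl | hij
  · rfl
  let c : V → ℂ := fun k => if G.Adj i j ∧ (k = i ∨ k = j) then -1 else 1
  have hc : ∏ k, c k = 1 := by
    by_cases h : G.Adj i j
    · have : ∀ k, c k = (if k = i then -1 else 1) * (if k = j then -1 else 1) := by
        intro k
        by_cases h1 : k = i
        · subst h1; simp [c, h, hij]
        · simp [c, h, h1]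
      simp_rw [this, Finset.prod_mul_distrib]
      simp
    · simp [c, h]
  have hXZ := axis_matrix_anticomm (show Axis.X ≠ Axis.Z by simp)
  have hZX := axis_matrix_anticomm (show Axis.Z ≠ Axis.X by simp)
  unfold generator
  rw [tensorOp_mul, tensorOp_mul, ← one_smul ℂ (tensorOp _), ← hc, ← tensorOp_smul]
  congr 1
  funext k
  by_cases h1 : k = i
  · subst h1
    by_cases h : G.Adj k j
    · simp [c, hij, h, h.symm, hXZ]
    · have h' : ¬ G.Adj j k := fun h1 => h h1.symm
      simp [c, hij, h, h']
  · by_cases h2 : k = j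
    · subst h2
      by_cases h : G.Adj i k
      · simp [c, hij.symm, h, hZX]
      · simp [c, hij.symm, h]
    · simp only [c, h1, h2, or_self, and_false, if_false, one_smul]
      split_ifs <;> simp

/-- `X` is off-diagonal, while `Z` and the identity are diagonal. -/
theorem generator_apply_ne_zero {i : V} {x y : V → Fin 2} (h : generator G i x y ≠ 0) :
    x i ≠ y i ∧ ∀ k ≠ i, x k = y k := by
  classical
  have h1 := Finset.prod_ne_zero_iff.mp h
  constructor
  · intro hi
    refine h1 i (Finset.mem_univ i) ?_
    simp only [if_true, hi]
    generalize y i = b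
    fin_cases b <;> simp [Axis.matrix]
  · intro k hk
    have h2 := h1 k (Finset.mem_univ k)
    simp only [if_neg hk] at h2
    revert h2
    generalize x k = a
    generalize y k = b
    split_ifs <;> fin_cases a <;> fin_cases b <;> simp [Axis.matrix]

theorem exists_isGraphState : ∃ ψ, IsGraphState G ψ := by
  -- Starting from the basis vector at `0`, apply `1 + g_i` for each `i` in turn. The support
  -- condition is the invariant that keeps the result non-zero: `g_i` flips bit `i`, which was still
  -- `0`, so the amplitude at `0` stays `1`.
  have key : ∀ A : Finset V, ∃ φ : (V → Fin 2) → ℂ, φ 0 = 1 ∧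
      (∀ x, φ x ≠ 0 → ∀ k ∉ A, x k = 0) ∧ ∀ i ∈ A, (generator G i).mulVec φ = φ := by
    intro A
    induction A using Finset.induction_on with
    | empty =>
      refine ⟨Pi.single 0 1, by simp, fun x hx k _ => ?_, by simp⟩
      have : x = 0 := by
        by_contra h
        exact hx (Pi.single_eq_of_ne h _)
      rw [this]; rfl
    | insert i A hi ih =>
      obtain ⟨φ, h0, hsupp, hfix⟩ := ih
      have hne : ∀ x, (generator G i).mulVec φ x ≠ 0 → ∃ y, generator G i x y ≠ 0 ∧ φ y ≠ 0 := by
        intro x hx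
        obtain ⟨y, -, hy⟩ := Finset.exists_ne_zero_of_sum_ne_zero hx
        exact ⟨y, left_ne_zero_of_mul hy, right_ne_zero_of_mul hy⟩
      refine ⟨φ + (generator G i).mulVec φ, ?_, ?_, ?_⟩
      · have : (generator G i).mulVec φ 0 = 0 := by
          by_contra h
          obtain ⟨y, hy, hφ⟩ := hne _ h
          exact (generator_apply_ne_zero G hy).1 (hsupp y hφ i hi).symm
        simp [h0, this]
      · intro x hx k hk
        rw [Finset.mem_insert, not_or] at hk
        by_cases hφ : φ x = 0
        · obtain ⟨y, hy, hφ⟩ := hne x (by simpa [hφ] using hx)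
          rw [(generator_apply_ne_zero G hy).2 k hk.1, hsupp y hφ k hk.2]
        · exact hsupp x hφ k hk.2
      · intro j hj
        rw [Matrix.mulVec_add, Matrix.mulVec_mulVec]
        rcases Finset.mem_insert.mp hj with rfl | hj
        · rw [generator_mul_self, Matrix.one_mulVec, add_comm]
        · rw [generator_commute, ← Matrix.mulVec_mulVec, hfix j hj]
  obtain ⟨φ, h0, -, hfix⟩ := key Finset.univ
  have hφ : WithLp.toLp 2 φ ≠ (0 : EuclideanSpace ℂ (V → Fin 2)) := by
    intro h
    have : φ 0 = 0 := congrArg (fun v : EuclideanSpace ℂ (V → Fin 2) => v 0) h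
    simp [h0] at this
  set r := ‖WithLp.toLp 2 φ‖ with hr
  have hr0 : (r : ℂ) ≠ 0 := by simpa [hr] using hφ
  have hdot : star φ ⬝ᵥ φ = (r : ℂ) ^ 2 := by
    rw [dotProduct_comm, ← EuclideanSpace.inner_toLp_toLp, inner_self_eq_norm_sq_to_K]
    rfl
  refine ⟨(r : ℂ)⁻¹ • φ, ?_, fun i => ?_⟩
  · rw [star_smul, smul_dotProduct, dotProduct_smul, hdot]
    simp
    field_simp
  · rw [Matrix.mulVec_smul, hfix i (Finset.mem_univ i)]

variable {G}

theorem IsGraphState.mulVec_eq {ψ : (V → Fin 2) → ℂ} (hψ : IsGraphState G ψ)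
    {s : Matrix (V → Fin 2) (V → Fin 2) ℂ}
    (hs : s ∈ Submonoid.closure (Set.range (generator G))) : s.mulVec ψ = ψ := by
  induction hs using Submonoid.closure_induction with
  | mem s hs =>
    obtain ⟨i, rfl⟩ := hs
    exact hψ.2 i
  | one => exact Matrix.one_mulVec ψ
  | mul s t _ _ hs ht => rw [← Matrix.mulVec_mulVec, ht, hs]

theorem IsGraphState.ne_zero {ψ : (V → Fin 2) → ℂ} (hψ : IsGraphState G ψ) : ψ ≠ 0 := by
  rintro rfl
  simpa using hψ.1

/-- The identity is the only multiple of itself in the stabilizer group. -/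
theorem eq_one_of_smul_one_mem {c : ℂ}
    (h : c • (1 : Matrix (V → Fin 2) (V → Fin 2) ℂ) ∈
      Submonoid.closure (Set.range (generator G))) : c = 1 := by
  obtain ⟨ψ, hψ⟩ := exists_isGraphState G
  have h1 := hψ.mulVec_eq h
  rw [Matrix.smul_mulVec, Matrix.one_mulVec] at h1
  exact smul_left_injective ℂ hψ.ne_zero (by simpa using h1)

/-- Every nonempty product of distinct generators is, up to a sign, a Pauli string. -/
theorem exists_stabilizer (T : V → ZMod 2) (hT : T ≠ 0) :
    ∃ s ∈ stabilizers G, ∃ ε : ℤˣ, s = ((ε : ℤ) : ℂ) • stabilizerString G T := by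
  obtain ⟨s, hs, c, rfl⟩ := exists_mem_closure_eq_smul_stabilizerString G T
  -- Strings square to the identity, so the square of `c • string` is `c * c` times the identity,
  -- and it lies in the group.
  have hc : c * c = 1 := by
    refine eq_one_of_smul_one_mem (G := G) ?_
    have := mul_mem hs hs
    rwa [Matrix.smul_mul, Matrix.mul_smul, stabilizerString_mul_self, smul_smul] at this
  refine ⟨_, ⟨hs, fun h => hT ?_⟩, ?_⟩
  · rw [← stabilizerString_zero G] at h
    exact stabilizerAxes_injective G (eq_of_tensorOp_pauliMatrix_eq_smul
      (c := c) (by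
        have h2 := congrArg (fun M => c • M) h
        simpa only [smul_smul, hc, one_smul, stabilizerString] using h2))
  · rcases mul_self_eq_one_iff.mp hc with rfl | rfl
    · exact ⟨1, by simp⟩
    · exact ⟨-1, by simp⟩

end TensorProducts

/-! ### Measurement outcomes at one qubit -/

/-- The Pauli matrix of a measurement, with the sign of its outcome. -/
noncomputable def signedMatrix : Option (Axis × ℤˣ) → Matrix (Fin 2) (Fin 2) ℂ
  | none => 1
  | some (a, ε) => ((ε : ℤ) : ℂ) • a.matrix

/-- The projector on an outcome. -/
noncomputable def localProjector : Option (Axis × ℤˣ) → Matrix (Fin 2) (Fin 2) ℂ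
  | none => 1
  | some (a, ε) => (1 / 2 : ℂ) • (1 + ((ε : ℤ) : ℂ) • a.matrix)

open Classical in
/-- The possible outcomes of a measurement. -/
noncomputable def localOutcomes : Option Axis → Finset (Option (Axis × ℤˣ))
  | none => {none}
  | some a => {some (a, 1), some (a, -1)}

theorem units_mul_self (ε : ℤˣ) : ((ε : ℤ) : ℂ) * ((ε : ℤ) : ℂ) = 1 := by
  rcases Int.units_eq_one_or ε with rfl | rfl <;> simp

theorem signedMatrix_mul_self (o : Option (Axis × ℤˣ)) :
    signedMatrix o * signedMatrix o = 1 := by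
  rcases o with _ | ⟨a, ε⟩
  · simp [signedMatrix]
  · simp [signedMatrix, axis_matrix_mul_self, smul_smul, units_mul_self]

/-- Two anticommuting involutions; this is the only source of the minus sign in the paradox. -/
theorem signedMatrix_mul_mul_mul_of_ne {o p : Option (Axis × ℤˣ)} {a b : Axis}
    (ho : o.map Prod.fst = some a) (hp : p.map Prod.fst = some b) (hab : a ≠ b) :
    signedMatrix o * signedMatrix p * signedMatrix o * signedMatrix p = -1 := by
  have h : signedMatrix o * signedMatrix p = -(signedMatrix p * signedMatrix o) := by
    rcases o with _ | ⟨a', ε⟩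
    · simp at ho
    rcases p with _ | ⟨b', δ⟩
    · simp at hp
    simp only [Option.map_some, Option.some.injEq] at ho hp
    subst ho hp
    simp only [signedMatrix, Matrix.smul_mul, Matrix.mul_smul, axis_matrix_anticomm hab, smul_neg]
    rw [smul_comm]
  rw [h, neg_mul, neg_mul, mul_assoc (signedMatrix p), signedMatrix_mul_self, mul_one,
    signedMatrix_mul_self]

theorem localProjector_some (a : Axis) (ε : ℤˣ) :
    localProjector (some (a, ε)) = (1 / 2 : ℂ) • (1 + signedMatrix (some (a, ε))) := rfl

theorem localProjector_mul_signedMatrix (o : Option (Axis × ℤˣ)) :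
    localProjector o * signedMatrix o = localProjector o := by
  rcases o with _ | ⟨a, ε⟩
  · simp [localProjector, signedMatrix]
  · rw [localProjector_some, Matrix.smul_mul, add_mul, signedMatrix_mul_self, one_mul, add_comm]

theorem localProjector_mul_self (o : Option (Axis × ℤˣ)) :
    localProjector o * localProjector o = localProjector o := by
  rcases o with _ | ⟨a, ε⟩
  · simp [localProjector]
  · nth_rewrite 2 [localProjector_some]
    rw [Matrix.mul_smul, mul_add, mul_one, localProjector_mul_signedMatrix, ← two_smul ℂ,
      smul_smul]
    norm_num

theorem localProjector_mul_of_ne (a : Axis) {ε δ : ℤˣ} (h : ε ≠ δ) :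
    localProjector (some (a, ε)) * localProjector (some (a, δ)) = 0 := by
  have hδ : signedMatrix (some (a, δ)) = -signedMatrix (some (a, ε)) := by
    rw [Int.units_ne_iff_eq_neg.mp h]
    simp [signedMatrix]
  rw [localProjector_some a δ, hδ, Matrix.mul_smul, mul_add, mul_one, mul_neg,
    localProjector_mul_signedMatrix, add_neg_cancel, smul_zero]

theorem localProjector_conjTranspose (o : Option (Axis × ℤˣ)) :
    (localProjector o).conjTranspose = localProjector o := by
  rcases o with _ | ⟨a, ε⟩
  · simp [localProjector]
  · simp [localProjector, Matrix.conjTranspose_smul, axis_matrix_conjTranspose]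

theorem trace_localProjector_ne_zero (o : Option (Axis × ℤˣ)) :
    (localProjector o).trace ≠ 0 := by
  rcases o with _ | ⟨a, ε⟩
  · simp [localProjector]
  · simp [localProjector, trace_axis_matrix]

theorem mem_localOutcomes {a : Option Axis} {o : Option (Axis × ℤˣ)} :
    o ∈ localOutcomes a ↔ o.map Prod.fst = a := by
  rcases a with _ | a <;> rcases o with _ | ⟨b, ε⟩
  · simp [localOutcomes]
  · simp [localOutcomes]
  · simp [localOutcomes]
  · rcases Int.units_eq_one_or ε with rfl | rfl <;> simp [localOutcomes]

theorem sum_localProjector (a : Option Axis) : ∑ o ∈ localOutcomes a, localProjector o = 1 := by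
  classical
  rcases a with _ | a
  · simp [localOutcomes, localProjector]
  · rw [localOutcomes, Finset.sum_pair (by simp)]
    simp only [localProjector, ← smul_add]
    simp only [Units.val_one, Int.cast_one, one_smul, Units.val_neg, Int.cast_neg, neg_smul]
    rw [add_add_add_comm, add_neg_cancel, add_zero, ← two_smul ℂ, smul_smul]
    norm_num

/-! ### Outcome strings -/

section Outcomes

variable {V : Type*} [Fintype V] [DecidableEq V] {G : SimpleGraph V}

theorem measuredOp_eq (e : OutcomeString V) :
    measuredOp e = tensorOp fun k => pauliMatrix ((e k).map Prod.fst) := by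
  unfold measuredOp
  congr 1
  funext k
  rcases e k with _ | ⟨a, ε⟩ <;> rfl

theorem outcomeProjector_eq (e : OutcomeString V) :
    outcomeProjector e = tensorOp fun k => localProjector (e k) := by
  unfold outcomeProjector
  congr 1

theorem outcomeSign_smul_measuredOp (e : OutcomeString V) :
    ((outcomeSign e : ℤ) : ℂ) • measuredOp e = tensorOp fun k => signedMatrix (e k) := by
  unfold measuredOp outcomeSign
  rw [Units.coe_prod, Int.cast_prod, ← tensorOp_smul]
  congr 1
  funext k
  rcases e k with _ | ⟨a, ε⟩ <;> simp [signedMatrix]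

theorem outcomeProjector_mul_self (e : OutcomeString V) :
    outcomeProjector e * outcomeProjector e = outcomeProjector e := by
  simp only [outcomeProjector_eq, tensorOp_mul, localProjector_mul_self]

theorem outcomeProjector_mul_of_exclusive {e f : OutcomeString V} (h : Exclusive e f) :
    outcomeProjector e * outcomeProjector f = 0 := by
  obtain ⟨k, a, ε, δ, he, hf, hne⟩ := h
  rw [outcomeProjector_eq, outcomeProjector_eq, tensorOp_mul]
  exact tensorOp_eq_zero (k := k) (by rw [he, hf, localProjector_mul_of_ne a hne])

theorem star_outcomeProjector_mulVec_dotProduct (e f : OutcomeString V)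
    (x y : (V → Fin 2) → ℂ) :
    star ((outcomeProjector e).mulVec x) ⬝ᵥ (outcomeProjector f).mulVec y =
      star x ⬝ᵥ (outcomeProjector e * outcomeProjector f).mulVec y := by
  have h : (outcomeProjector e).conjTranspose = outcomeProjector e := by
    simp only [outcomeProjector_eq, tensorOp_conjTranspose, localProjector_conjTranspose]
  rw [Matrix.star_mulVec, h, ← Matrix.mulVec_mulVec, Matrix.dotProduct_mulVec (star x)]

theorem outcomeProbability_eq (ψ : (V → Fin 2) → ℂ) (e : OutcomeString V) :
    outcomeProbability ψ e = (‖WithLp.toLp 2 ((outcomeProjector e).mulVec ψ)‖ : ℂ) ^ 2 := by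
  rw [outcomeProbability, ← outcomeProjector_mul_self,
    ← star_outcomeProjector_mulVec_dotProduct, dotProduct_comm,
    ← EuclideanSpace.inner_toLp_toLp, inner_self_eq_norm_sq_to_K, outcomeProjector_mul_self]
  rfl

/-- The trace of the projector is a product of non-zero local traces. This supplies a unit vector
for events whose projector kills the graph state. -/
theorem exists_outcomeProjector_mulVec_ne_zero (e : OutcomeString V) :
    ∃ x, (outcomeProjector e).mulVec x ≠ 0 := by
  by_contra! h
  have h0 : outcomeProjector e = 0 := Matrix.toLin'.injective (LinearMap.ext fun x => by
    simpa using h x)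
  have := trace_tensorOp fun k => localProjector (e k)
  rw [← outcomeProjector_eq, h0, Matrix.trace_zero] at this
  exact Finset.prod_ne_zero_iff.mpr (fun k _ => trace_localProjector_ne_zero (e k)) this.symm

/-- The outcomes of a complete set of local measurements have total probability `1`. -/
theorem sum_outcomeProbability {ψ : (V → Fin 2) → ℂ} (hψ : star ψ ⬝ᵥ ψ = 1)
    (a : V → Option Axis) :
    ∑ e ∈ Fintype.piFinset fun k => localOutcomes (a k), outcomeProbability ψ e = 1 := by
  simp only [outcomeProbability, outcomeProjector_eq]
  rw [← dotProduct_sum, ← Matrix.sum_mulVec, sum_tensorOp]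
  simp only [sum_localProjector, tensorOp_one, Matrix.one_mulVec, hψ]

theorem eq_of_not_exclusive {e f : OutcomeString V} (h : ¬ Exclusive e f) {k : V}
    (hk : (e k).map Prod.fst = (f k).map Prod.fst) : e k = f k := by
  rcases he : e k with _ | ⟨a, ε⟩ <;> rcases hf : f k with _ | ⟨b, δ⟩ <;> rw [he, hf] at hk
  · simp at hk
  · simp at hk
  · simp only [Option.map_some, Option.some.injEq] at hk
    subst hk
    by_contra hne
    exact h ⟨k, a, ε, δ, he, hf, fun h => hne (by rw [h])⟩

/-! ### Events of stabilizing operators -/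

/-- The sign condition on an event says exactly that absorbing each outcome into its Pauli factor
recovers `s` itself, sign included. -/
theorem tensorOp_signedMatrix_mem {e : OutcomeString V} (he : e ∈ stabilizerEvents G) :
    (tensorOp fun k => signedMatrix (e k)) ∈ Submonoid.closure (Set.range (generator G)) := by
  obtain ⟨s, hs, rfl⟩ := he
  rw [← outcomeSign_smul_measuredOp]
  exact hs.1

theorem exists_axes_of_smul_measuredOp_mem {e : OutcomeString V} {ε : ℤˣ}
    (hs : ((ε : ℤ) : ℂ) • measuredOp e ∈ stabilizers G) :
    ∃ T : V → ZMod 2, T ≠ 0 ∧ ∀ k, (e k).map Prod.fst = stabilizerAxes G T k := by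
  obtain ⟨T, c, hc⟩ := exists_eq_smul_stabilizerString G hs.1
  refine ⟨T, ?_, fun k => ?_⟩
  · rintro rfl
    rw [stabilizerString_zero] at hc
    refine hs.2 ?_
    have h1 := hs.1
    rw [hc] at h1
    rw [hc, eq_one_of_smul_one_mem h1, one_smul]
  · rw [measuredOp_eq] at hc
    have h := congrArg (fun M => ((ε : ℤ) : ℂ) • M) hc
    simp only [smul_smul, units_mul_self, one_smul] at h
    exact congrFun (eq_of_tensorOp_pauliMatrix_eq_smul h) k

theorem exists_axes_of_mem_stabilizerEvents {e : OutcomeString V}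
    (he : e ∈ stabilizerEvents G) :
    ∃ T : V → ZMod 2, T ≠ 0 ∧ ∀ k, (e k).map Prod.fst = stabilizerAxes G T k := by
  obtain ⟨s, hs, rfl⟩ := he
  exact exists_axes_of_smul_measuredOp_mem hs

/-- On the range of `P_e` the measured operator acts as the product of the outcomes, while `s` fixes
`ψ`. If `P_e ψ ≠ 0`, the two signs must agree. -/
theorem occurringEvents_subset_stabilizerEvents :
    occurringEvents G ⊆ stabilizerEvents G := by
  rintro e ⟨⟨s, hs, ε, rfl⟩, ψ, hψ, hp⟩
  have hP : (outcomeProjector e).mulVec ψ ≠ 0 := by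
    intro h
    rw [outcomeProbability, h, dotProduct_zero] at hp
    exact hp rfl
  have hsign : outcomeProjector e * measuredOp e =
      ((outcomeSign e : ℤ) : ℂ) • outcomeProjector e := by
    have h : outcomeProjector e * ((outcomeSign e : ℤ) : ℂ) • measuredOp e =
        outcomeProjector e := by
      simp only [outcomeSign_smul_measuredOp, outcomeProjector_eq, tensorOp_mul,
        localProjector_mul_signedMatrix]
    nth_rewrite 2 [← h]
    rw [Matrix.mul_smul, smul_smul, units_mul_self, one_smul]
  have h1 := congrArg (outcomeProjector e).mulVec (hψ.mulVec_eq hs.1)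
  rw [Matrix.mulVec_mulVec, Matrix.mul_smul, hsign, smul_smul, Matrix.smul_mulVec] at h1
  have h2 : ((ε : ℤ) : ℂ) * ((outcomeSign e : ℤ) : ℂ) = 1 :=
    smul_left_injective ℂ hP (by simpa using h1)
  have h3 : ε = outcomeSign e := by
    have h4 : ε * outcomeSign e = 1 := by
      have h5 : (ε : ℤ) * (outcomeSign e : ℤ) = 1 := by exact_mod_cast h2
      exact Units.ext h5
    rw [eq_comm, ← Int.units_inv_eq_self ε]
    exact (inv_eq_of_mul_eq_one_right h4).symm
  exact ⟨_, hs, by rw [h3]⟩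

/-- Distinct outcomes of the same measurements are exclusive. -/
theorem exclusive_of_ne {e f : OutcomeString V} (hne : e ≠ f)
    (h : ∀ k, (e k).map Prod.fst = (f k).map Prod.fst) : Exclusive e f := by
  by_contra hex
  exact hne (funext fun k => eq_of_not_exclusive hex (h k))

/-! ### The value `2 ^ n - 1`: clique cover and total probability -/

variable {E : Set (OutcomeString V)}

theorem card_univ_erase_zero :
    (Finset.univ.erase (0 : V → ZMod 2)).card = 2 ^ Fintype.card V - 1 := by
  rw [Finset.card_erase_of_mem (Finset.mem_univ _), Finset.card_univ, Fintype.card_fun,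
    ZMod.card]

/-- The events of one stabilizing operator form a clique. -/
theorem le_of_mem_fractionalPackingValues (hE : E ⊆ stabilizerEvents G) {r : ℝ}
    (hr : r ∈ fractionalPackingValues (exclusivityGraph E)) : r ≤ 2 ^ Fintype.card V - 1 := by
  obtain ⟨w, hw, rfl⟩ := hr
  choose T hT0 hT using fun e : E => exists_axes_of_mem_stabilizerEvents (hE e.2)
  refine (sum_le_card_of_clique_cover hw T (Finset.univ.erase 0)
    (fun e => Finset.mem_erase.mpr ⟨hT0 e, Finset.mem_univ _⟩) fun e f hne h => ?_).trans
    (le_of_eq ?_)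
  · exact exclusive_of_ne (fun h => hne (Subtype.ext h)) fun k => by rw [hT e k, hT f k, h]
  · rw [card_univ_erase_zero, Nat.cast_sub Nat.one_le_two_pow]
    simp

/-- The normalised post-measurement states of a graph state form an orthogonal representation of
the exclusivity graph. -/
theorem sum_norm_sq_mem_lovaszValues {ψ : (V → Fin 2) → ℂ} (hψ : IsGraphState G ψ) :
    ∑ e : E, ‖WithLp.toLp 2 ((outcomeProjector e.1).mulVec ψ)‖ ^ 2 ∈
      lovaszValues (exclusivityGraph E) := by
  -- If `P_e ψ = 0`, any non-zero vector in the range of `P_e` will do: orthogonality to exclusive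
  -- events persists, and its overlap with `ψ` is `0`.
  have hx : ∀ e : OutcomeString V, ∃ x, (outcomeProjector e).mulVec x ≠ 0 ∧
      ((outcomeProjector e).mulVec ψ ≠ 0 → x = ψ) := by
    intro e
    by_cases h : (outcomeProjector e).mulVec ψ = 0
    · obtain ⟨x, hx⟩ := exists_outcomeProjector_mulVec_ne_zero e
      exact ⟨x, hx, fun h' => absurd h h'⟩
    · exact ⟨ψ, h, fun _ => rfl⟩
  choose x hx0 hxψ using hx
  let y : OutcomeString V → EuclideanSpace ℂ (V → Fin 2) := fun e =>
    WithLp.toLp 2 ((outcomeProjector e).mulVec (x e))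
  have hy : ∀ e, ‖y e‖ ≠ 0 := fun e h => hx0 e (by
    have h1 := norm_eq_zero.mp h
    exact congrArg WithLp.ofLp h1)
  have key := mem_lovaszValues (H := exclusivityGraph E)
    (fun e => ((‖y e.1‖ : ℂ)⁻¹) • y e.1) (WithLp.toLp 2 ψ) ?_ ?_ ?_
  · convert key using 1
    refine Finset.sum_congr rfl fun e _ => ?_
    have h1 : (inner ℂ (WithLp.toLp 2 ψ) (y e.1) : ℂ) =
        inner ℂ (WithLp.toLp 2 ((outcomeProjector e.1).mulVec ψ)) (y e.1) := by
      simp only [y]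
      rw [EuclideanSpace.inner_toLp_toLp, EuclideanSpace.inner_toLp_toLp, dotProduct_comm,
        dotProduct_comm _ (star (Matrix.mulVec _ _)), star_outcomeProjector_mulVec_dotProduct,
        outcomeProjector_mul_self]
    rw [inner_smul_right, h1]
    by_cases h : (outcomeProjector e.1).mulVec ψ = 0
    · rw [h]
      simp
    · have h2 : y e.1 = WithLp.toLp 2 ((outcomeProjector e.1).mulVec ψ) := by
        simp only [y, hxψ _ h]
      rw [← h2, inner_self_eq_norm_sq_to_K, norm_mul, norm_inv, norm_pow]
      simp only [Complex.coe_algebraMap, Complex.norm_real, norm_norm]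
      have := hy e.1
      field_simp
  · intro e
    rw [norm_smul, norm_inv, Complex.norm_real, norm_norm, inv_mul_cancel₀ (hy e.1)]
  · intro e f hef
    rw [inner_smul_left, inner_smul_right]
    simp only [y]
    rw [EuclideanSpace.inner_toLp_toLp, dotProduct_comm, star_outcomeProjector_mulVec_dotProduct,
      outcomeProjector_mul_of_exclusive hef]
    simp
  · have h1 : (inner ℂ (WithLp.toLp 2 ψ) (WithLp.toLp 2 ψ) : ℂ) = 1 := by
      rw [EuclideanSpace.inner_toLp_toLp, dotProduct_comm, hψ.1]
    rw [inner_self_eq_norm_sq_to_K] at h1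
    have h2 : ‖WithLp.toLp 2 ψ‖ ^ 2 = 1 := Complex.ofReal_injective (by simpa using h1)
    exact (pow_eq_one_iff_of_nonneg (norm_nonneg _) two_ne_zero).mp h2

/-- Each stabilizing operator contributes total probability `1`. -/
theorem two_pow_sub_one_le_sum (hE : occurringEvents G ⊆ E) {ψ : (V → Fin 2) → ℂ}
    (hψ : IsGraphState G ψ) :
    (2 : ℝ) ^ Fintype.card V - 1 ≤
      ∑ e : E, ‖WithLp.toLp 2 ((outcomeProjector e.1).mulVec ψ)‖ ^ 2 := by
  classical
  let p : OutcomeString V → ℝ := fun e => ‖WithLp.toLp 2 ((outcomeProjector e).mulVec ψ)‖ ^ 2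
  have hp : ∀ e, outcomeProbability ψ e = p e := fun e => by
    rw [outcomeProbability_eq]; simp [p]
  let S : (V → ZMod 2) → Finset (OutcomeString V) := fun T =>
    Fintype.piFinset fun k => localOutcomes (stabilizerAxes G T k)
  have hS : ∀ {T e}, e ∈ S T ↔ ∀ k, (e k).map Prod.fst = stabilizerAxes G T k := by
    intro T e
    simp only [S, Fintype.mem_piFinset, mem_localOutcomes]
  have hsum : ∀ T, ∑ e ∈ S T, p e = 1 := by
    intro T
    have := sum_outcomeProbability hψ.1 (stabilizerAxes G T)
    simp only [hp] at this
    exact_mod_cast this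
  have hdisj : (↑(Finset.univ.erase (0 : V → ZMod 2)) : Set (V → ZMod 2)).PairwiseDisjoint S := by
    intro T _ U _ hTU
    refine Finset.disjoint_left.mpr fun e hT hU => hTU (stabilizerAxes_injective G ?_)
    funext k
    rw [← hS.mp hT k, hS.mp hU k]
  calc (2 : ℝ) ^ Fintype.card V - 1
      = ∑ T ∈ Finset.univ.erase (0 : V → ZMod 2), ∑ e ∈ S T, p e := by
        simp only [hsum, Finset.sum_const, card_univ_erase_zero, nsmul_eq_mul, mul_one]
        rw [Nat.cast_sub Nat.one_le_two_pow]
        simp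
    _ = ∑ e ∈ (Finset.univ.erase (0 : V → ZMod 2)).biUnion S, p e :=
        (Finset.sum_biUnion hdisj).symm
    _ = ∑ e ∈ (Finset.univ.erase (0 : V → ZMod 2)).biUnion S with p e ≠ 0, p e :=
        (Finset.sum_filter_ne_zero _).symm
    -- `S T` contains all outcome strings, including those of the wrong sign. After discarding zero
    -- probabilities, only occurring events remain, and these lie in `E`.
    _ ≤ ∑ e ∈ E.toFinite.toFinset, p e := by
        refine Finset.sum_le_sum_of_subset_of_nonneg (fun e he => ?_) fun e _ _ => by positivity
        obtain ⟨he, hpe⟩ := Finset.mem_filter.mp he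
        obtain ⟨T, hT, he⟩ := Finset.mem_biUnion.mp he
        rw [Set.Finite.mem_toFinset]
        obtain ⟨s, hs, ε, rfl⟩ := exists_stabilizer (G := G) T (Finset.mem_erase.mp hT).1
        refine hE ⟨⟨_, hs, ε, ?_⟩, ψ, hψ, by rw [hp]; exact_mod_cast hpe⟩
        rw [measuredOp_eq]
        simp only [hS.mp he]
        rfl
    _ = ∑ e : E, p e := Finset.sum_subtype _ (fun e => by simp) p

/-! ### Absence of a consistent assignment of outcomes -/

/-- All four factors are `I` or `±Z`, with an even number of `Z`s, and compatibility gives every `Z`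
the same sign. -/
theorem signedMatrix_mul_mul_mul_eq_one {o₁ o₂ o₃ o₄ : Option (Axis × ℤˣ)} {b₁ b₂ b₃ b₄ : ZMod 2}
    (h₁ : o₁.map Prod.fst = pauliAxis 0 b₁) (h₂ : o₂.map Prod.fst = pauliAxis 0 b₂)
    (h₃ : o₃.map Prod.fst = pauliAxis 0 b₃) (h₄ : o₄.map Prod.fst = pauliAxis 0 b₄)
    (hb : b₁ + b₂ + b₃ + b₄ = 0)
    (h₁₂ : o₁.map Prod.fst = o₂.map Prod.fst → o₁ = o₂)
    (h₁₃ : o₁.map Prod.fst = o₃.map Prod.fst → o₁ = o₃)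
    (h₁₄ : o₁.map Prod.fst = o₄.map Prod.fst → o₁ = o₄)
    (h₂₃ : o₂.map Prod.fst = o₃.map Prod.fst → o₂ = o₃)
    (h₂₄ : o₂.map Prod.fst = o₄.map Prod.fst → o₂ = o₄)
    (h₃₄ : o₃.map Prod.fst = o₄.map Prod.fst → o₃ = o₄) :
    signedMatrix o₁ * signedMatrix o₂ * signedMatrix o₃ * signedMatrix o₄ = 1 := by
  rw [h₁, h₂] at h₁₂
  rw [h₁, h₃] at h₁₃
  rw [h₁, h₄] at h₁₄
  rw [h₂, h₃] at h₂₃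
  rw [h₂, h₄] at h₂₄
  rw [h₃, h₄] at h₃₄
  -- The last alternative is the interlaced pairing. When all four are equal the first applies, so
  -- here one of the two pairs can be taken to be the identity.
  have key : ∀ b₁ b₂ b₃ b₄ : ZMod 2, b₁ + b₂ + b₃ + b₄ = 0 →
      (b₁ = b₂ ∧ b₃ = b₄) ∨ (b₁ = b₄ ∧ b₂ = b₃) ∨
        (b₁ = b₃ ∧ b₂ = b₄ ∧ (b₁ = 0 ∨ b₂ = 0)) := by decide
  have hnone : ∀ {o : Option (Axis × ℤˣ)}, o.map Prod.fst = pauliAxis 0 0 → o = none := by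
    intro o ho
    simpa [pauliAxis] using ho
  rcases key _ _ _ _ hb with ⟨h, h'⟩ | ⟨h, h'⟩ | ⟨h, h', h0⟩
  · rw [h₁₂ (by rw [h]), h₃₄ (by rw [h']), signedMatrix_mul_self, one_mul, signedMatrix_mul_self]
  · rw [h₁₄ (by rw [h]), h₂₃ (by rw [h']), mul_assoc (signedMatrix o₄), signedMatrix_mul_self,
      mul_one, signedMatrix_mul_self]
  · rw [← h₁₃ (by rw [h]), ← h₂₄ (by rw [h'])]
    rcases h0 with rfl | rfl
    · rw [hnone h₁]
      simp [show signedMatrix none = 1 from rfl, signedMatrix_mul_self]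
    · rw [hnone h₂]
      simp [show signedMatrix none = 1 from rfl, signedMatrix_mul_self]

/-- Four stabilizing operators cannot have pairwise compatible events if their Pauli strings pair
up at every qubit, the pairs being interlaced and anticommuting at exactly one qubit `j`. -/
theorem false_of_compatible_events {e : (V → ZMod 2) → OutcomeString V}
    (he : ∀ T ≠ 0, e T ∈ stabilizerEvents G)
    (hax : ∀ T ≠ 0, ∀ k, (e T k).map Prod.fst = stabilizerAxes G T k)
    (hex : ∀ T ≠ 0, ∀ U ≠ 0, ¬ Exclusive (e T) (e U))
    {T₁ T₂ T₃ T₄ : V → ZMod 2} (h₁ : T₁ ≠ 0) (h₂ : T₂ ≠ 0) (h₃ : T₃ ≠ 0) (h₄ : T₄ ≠ 0)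
    (j : V) {a b : Axis} (hab : a ≠ b)
    (hj₁ : stabilizerAxes G T₁ j = some a) (hj₂ : stabilizerAxes G T₂ j = some b)
    (hj₃ : stabilizerAxes G T₃ j = some a) (hj₄ : stabilizerAxes G T₄ j = some b)
    (hpair : ∀ l ≠ j,
      (stabilizerAxes G T₁ l = stabilizerAxes G T₂ l ∧
        stabilizerAxes G T₃ l = stabilizerAxes G T₄ l) ∨
      (stabilizerAxes G T₁ l = stabilizerAxes G T₄ l ∧
        stabilizerAxes G T₂ l = stabilizerAxes G T₃ l) ∨
      (T₁ l = 0 ∧ T₂ l = 0 ∧ T₃ l = 0 ∧ T₄ l = 0 ∧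
        nbrParity G T₁ l + nbrParity G T₂ l + nbrParity G T₃ l + nbrParity G T₄ l = 0)) :
    False := by
  have heq : ∀ T ≠ 0, ∀ U ≠ 0, ∀ k, stabilizerAxes G T k = stabilizerAxes G U k →
      e T k = e U k := fun T hT U hU k h =>
    eq_of_not_exclusive (hex T hT U hU) (by rw [hax T hT, hax U hU, h])
  have hprod : (tensorOp fun k => signedMatrix (e T₁ k) * signedMatrix (e T₂ k) *
      signedMatrix (e T₃ k) * signedMatrix (e T₄ k)) =
      (-1 : ℂ) • (1 : Matrix (V → Fin 2) (V → Fin 2) ℂ) := by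
    have hc : ∏ k, (if k = j then (-1 : ℂ) else 1) = -1 := by simp
    rw [← tensorOp_one, ← hc, ← tensorOp_smul]
    congr 1
    funext l
    by_cases hl : l = j
    · subst hl
      rw [if_pos rfl, ← heq T₁ h₁ T₃ h₃ l (by rw [hj₁, hj₃]),
        ← heq T₂ h₂ T₄ h₄ l (by rw [hj₂, hj₄]),
        signedMatrix_mul_mul_mul_of_ne ((hax _ h₁ l).trans hj₁) ((hax _ h₂ l).trans hj₂) hab,
        neg_smul, one_smul]
    · rw [if_neg hl, one_smul]
      rcases hpair l hl with ⟨h, h'⟩ | ⟨h, h'⟩ | ⟨t₁, t₂, t₃, t₄, h⟩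
      · rw [heq _ h₁ _ h₂ l h, heq _ h₃ _ h₄ l h', signedMatrix_mul_self, one_mul,
          signedMatrix_mul_self]
      · rw [heq _ h₁ _ h₄ l h, heq _ h₂ _ h₃ l h', mul_assoc (signedMatrix (e T₄ l)),
          signedMatrix_mul_self, mul_one, signedMatrix_mul_self]
      · exact signedMatrix_mul_mul_mul_eq_one
          ((hax _ h₁ l).trans (by rw [stabilizerAxes, t₁]))
          ((hax _ h₂ l).trans (by rw [stabilizerAxes, t₂]))
          ((hax _ h₃ l).trans (by rw [stabilizerAxes, t₃]))
          ((hax _ h₄ l).trans (by rw [stabilizerAxes, t₄])) h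
          (eq_of_not_exclusive (hex _ h₁ _ h₂)) (eq_of_not_exclusive (hex _ h₁ _ h₃))
          (eq_of_not_exclusive (hex _ h₁ _ h₄)) (eq_of_not_exclusive (hex _ h₂ _ h₃))
          (eq_of_not_exclusive (hex _ h₂ _ h₄)) (eq_of_not_exclusive (hex _ h₃ _ h₄))
  have hmem := mul_mem (mul_mem (mul_mem (tensorOp_signedMatrix_mem (he _ h₁))
    (tensorOp_signedMatrix_mem (he _ h₂))) (tensorOp_signedMatrix_mem (he _ h₃)))
    (tensorOp_signedMatrix_mem (he _ h₄))
  rw [tensorOp_mul, tensorOp_mul, tensorOp_mul, hprod] at hmem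
  have := eq_one_of_smul_one_mem hmem
  norm_num at this

set_option linter.unusedSimpArgs false in
/-- The three-qubit paradox at a vertex with two neighbours. -/
theorem exists_exclusive_events {e : (V → ZMod 2) → OutcomeString V}
    (he : ∀ T ≠ 0, e T ∈ stabilizerEvents G)
    (hax : ∀ T ≠ 0, ∀ k, (e T k).map Prod.fst = stabilizerAxes G T k)
    {i j k : V} (hij : G.Adj i j) (hik : G.Adj i k) (hjk : j ≠ k) :
    ∃ T ≠ 0, ∃ U ≠ 0, Exclusive (e T) (e U) := by
  by_contra! hex
  have nij := hij.ne
  have nik := hik.ne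
  have nonzero : ∀ (T : V → ZMod 2) (l : V), T l = 1 → T ≠ 0 := by
    rintro T l h rfl
    simp at h
  have parity : ∀ u v w : ZMod 2, u + (u + v) + (u + w) + (u + v + w) = 0 ∧
      u + v + w + (u + v + w) = 0 := by decide
  by_cases h : G.Adj j k
  -- Triangle: `g_i`, `g_j`, `g_k` and their product. The factors are `Z, X, Z, X` at `j`, `X, Z, Z,
  -- X` at `i` and `Z, Z, X, X` at `k`, ignoring other qubits.
  · refine false_of_compatible_events he hax hex (T₁ := Pi.single i 1) (T₂ := Pi.single j 1)
      (T₃ := Pi.single k 1) (T₄ := Pi.single i 1 + Pi.single j 1 + Pi.single k 1)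
      (nonzero _ i ?_) (nonzero _ j ?_) (nonzero _ k ?_) (nonzero _ i ?_) j
      (a := .Z) (b := .X) (by simp) ?_ ?_ ?_ ?_ fun l hl => ?_
    all_goals try simp [stabilizerAxes, nbrParity_add, nbrParity_single, pauliAxis, h, hij,
      hij.symm, hik, hjk, hjk.symm, nij, nij.symm, nik, CharTwo.add_self_eq_zero]
    by_cases hli : l = i
    · subst hli
      right; left
      simp [stabilizerAxes, nbrParity_add, nbrParity_single, hij, hik, nij, nik,
        CharTwo.add_self_eq_zero]
    by_cases hlk : l = k
    · subst hlk
      left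
      simp [stabilizerAxes, nbrParity_add, nbrParity_single, h.symm, hik.symm, hli, hl,
        CharTwo.add_self_eq_zero]
    right; right
    simp [nbrParity_add, (parity _ _ _).2, hl, hli, hlk]
  -- Path: `g_i`, `g_i g_j`, `g_i g_k`, `g_i g_j g_k`. Up to sign, the factors are `Z, Y, Z, Y` at
  -- `j`, `X, Y, Y, X` at `i` and `Z, Z, Y, Y` at `k`.
  · have h' : ¬ G.Adj k j := fun h1 => h h1.symm
    refine false_of_compatible_events he hax hex (T₁ := Pi.single i 1)
      (T₂ := Pi.single i 1 + Pi.single j 1)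
      (T₃ := Pi.single i 1 + Pi.single k 1) (T₄ := Pi.single i 1 + Pi.single j 1 + Pi.single k 1)
      (nonzero _ i ?_) (nonzero _ i ?_) (nonzero _ i ?_) (nonzero _ i ?_) j
      (a := .Z) (b := .Y) (by simp) ?_ ?_ ?_ ?_ fun l hl => ?_
    all_goals try simp [stabilizerAxes, nbrParity_add, nbrParity_single, pauliAxis, h, hij,
      hij.symm, hik, hjk, hjk.symm, nij, nij.symm, nik, CharTwo.add_self_eq_zero]
    by_cases hli : l = i
    · subst hli
      right; left
      simp [stabilizerAxes, nbrParity_add, nbrParity_single, hij, hik, nij, nik,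
        CharTwo.add_self_eq_zero]
    by_cases hlk : l = k
    · subst hlk
      left
      simp [stabilizerAxes, nbrParity_add, nbrParity_single, h', hik.symm, hli, hl]
    right; right
    simp [nbrParity_add, (parity _ _ _).1, hl, hli, hlk]

/-- A connected graph with more than two vertices has a vertex with two neighbours. -/
theorem exists_adj_adj_ne (hG : G.Connected)
    (hn : 2 < Fintype.card V) : ∃ i j k, G.Adj i j ∧ G.Adj i k ∧ j ≠ k := by
  have hcut : ∀ S : Finset V, S.Nonempty → S.card ≤ 2 → ∃ u ∈ S, ∃ v ∉ S, G.Adj u v := by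
    rintro S ⟨u, hu⟩ hS
    obtain ⟨v, hv⟩ : ∃ v, v ∉ S := by
      by_contra! h
      rw [Finset.eq_univ_iff_forall.mpr h, Finset.card_univ] at hS
      omega
    obtain ⟨p⟩ := hG.preconnected u v
    obtain ⟨d, -, h1, h2⟩ := p.exists_boundary_dart (S : Set V) hu hv
    exact ⟨d.fst, h1, d.snd, h2, d.adj⟩
  obtain ⟨u⟩ := hG.nonempty
  obtain ⟨u, -, v, -, huv⟩ := hcut {u} (by simp) (by simp)
  -- An edge leaving `{u, v}` starts at `u` or at `v`; that endpoint has the other one and `y` as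
  -- distinct neighbours.
  obtain ⟨x, hx, y, hy, hxy⟩ := hcut {u, v} (by simp) Finset.card_le_two
  simp only [Finset.mem_insert, Finset.mem_singleton, not_or] at hx hy
  rcases hx with rfl | rfl
  · exact ⟨x, v, y, huv, hxy, fun h => hy.2 h.symm⟩
  · exact ⟨x, u, y, huv.symm, hxy, fun h => hy.1 h.symm⟩

/-- An independent set meets each of the `2 ^ n - 1` cliques at most once. One of that size would
select an event for every `T ≠ 0`, pairwise non-exclusive, against the paradox. -/
theorem indepNum_lt (hG : G.Connected) (hn : 2 < Fintype.card V)
    (hE : E ⊆ stabilizerEvents G) :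
    (exclusivityGraph E).indepNum < 2 ^ Fintype.card V - 1 := by
  obtain ⟨I, hI, hcard⟩ := (exclusivityGraph E).exists_isNIndepSet_indepNum
  choose T hT0 hT using fun e : E => exists_axes_of_mem_stabilizerEvents (hE e.2)
  by_contra! hle
  have hinj : Set.InjOn T I := by
    intro e he f hf h
    by_contra hne
    exact hI he hf hne (exclusive_of_ne (fun h => hne (Subtype.ext h)) fun k => by
      rw [hT e k, hT f k, h])
  have hsurj := Finset.surjOn_of_injOn_of_card_le (s := I) (t := Finset.univ.erase 0) T
    (fun e _ => by simpa using hT0 e) hinj (by rw [card_univ_erase_zero, hcard]; exact hle)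
  have hex : ∀ U : V → ZMod 2, ∃ e : OutcomeString V, U ≠ 0 →
      ∃ f ∈ I, f.1 = e ∧ T f = U := by
    intro U
    by_cases hU : U = 0
    · exact ⟨fun _ => none, fun h => absurd hU h⟩
    · obtain ⟨f, hf, h⟩ := hsurj (show U ∈ _ by simpa using hU)
      exact ⟨f.1, fun _ => ⟨f, hf, rfl, h⟩⟩
  choose e he using hex
  obtain ⟨i, j, k, hij, hik, hjk⟩ := exists_adj_adj_ne hG hn
  obtain ⟨U, hU, U', hU', hUU'⟩ := exists_exclusive_events (G := G) (e := e)
    (fun U hU => by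
      obtain ⟨f, -, h, -⟩ := he U hU
      exact h ▸ hE f.2)
    (fun U hU k => by
      obtain ⟨f, -, h, rfl⟩ := he U hU
      rw [← h, hT f k]) hij hik hjk
  obtain ⟨f, hf, h, -⟩ := he U hU
  obtain ⟨f', hf', h', -⟩ := he U' hU'
  rw [← h, ← h'] at hUU'
  have hadj : (exclusivityGraph E).Adj f f' := hUU'
  exact hI hf hf' hadj.ne hadj

end Outcomes

end EventExclusivity

open EventExclusivity in
theorem theorem2 {V : Type*} [Fintype V] [DecidableEq V] (G : SimpleGraph V)
    (hG : G.Connected) (hn : 2 < Fintype.card V)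
    (E : Set (OutcomeString V)) (hE : E = stabilizerEvents G ∨ E = occurringEvents G) :
    IsGreatest (lovaszValues (exclusivityGraph E)) (lovaszNumber (exclusivityGraph E)) ∧
    IsGreatest (fractionalPackingValues (exclusivityGraph E))
      (fractionalPackingNumber (exclusivityGraph E)) ∧
    ((exclusivityGraph E).indepNum : ℝ) < lovaszNumber (exclusivityGraph E) ∧
    lovaszNumber (exclusivityGraph E) = fractionalPackingNumber (exclusivityGraph E) ∧
    fractionalPackingNumber (exclusivityGraph E) = 2 ^ Fintype.card V - 1 := by
  have hsub : E ⊆ stabilizerEvents G := by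
    rcases hE with rfl | rfl
    · exact subset_rfl
    · exact occurringEvents_subset_stabilizerEvents
  have hocc : occurringEvents G ⊆ E := by
    rcases hE with rfl | rfl
    · exact occurringEvents_subset_stabilizerEvents
    · exact subset_rfl
  obtain ⟨ψ, hψ⟩ := exists_isGraphState G
  have hmem := sum_norm_sq_mem_lovaszValues (E := E) hψ
  -- The clique cover bounds the graph-state value above and the total probability bounds it below,
  -- so it equals `2 ^ n - 1`.
  rw [le_antisymm (le_of_mem_fractionalPackingValues hsub
    (lovaszValues_subset_fractionalPackingValues hmem)) (two_pow_sub_one_le_sum hocc hψ)] at hmem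
  have hα : IsGreatest (fractionalPackingValues (exclusivityGraph E))
      ((2 : ℝ) ^ Fintype.card V - 1) :=
    ⟨lovaszValues_subset_fractionalPackingValues hmem,
      fun r hr => le_of_mem_fractionalPackingValues hsub hr⟩
  have hϑ : IsGreatest (lovaszValues (exclusivityGraph E)) ((2 : ℝ) ^ Fintype.card V - 1) :=
    ⟨hmem, fun r hr => hα.2 (lovaszValues_subset_fractionalPackingValues hr)⟩
  have hα' : fractionalPackingNumber (exclusivityGraph E) = 2 ^ Fintype.card V - 1 :=
    hα.csSup_eq
  have hϑ' : lovaszNumber (exclusivityGraph E) = 2 ^ Fintype.card V - 1 := hϑ.csSup_eq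
  rw [hα', hϑ']
  refine ⟨hϑ, hα, ?_, rfl, rfl⟩
  have h : ((exclusivityGraph E).indepNum : ℝ) < ((2 ^ Fintype.card V - 1 : ℕ) : ℝ) := by
    exact_mod_cast indepNum_lt hG hn hsub
  rwa [Nat.cast_sub Nat.one_le_two_pow, Nat.cast_pow, Nat.cast_ofNat, Nat.cast_one] at h
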